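/- Let $T$ be a set of base types. Simple types over $T$ are generated by $\tau ::= \theta \mid 1 \mid \tau_1 * \tau_2 \mid \tau_1 \Rightarrow \tau_2$ ($\theta\in T$). Let $\mathbb{C}$ be the category of typing contexts $\Gamma$ (finite lists of types) and type-preserving renamings of variables. For a type $\tau$ let $\mathcal{L}_\tau,\mathcal{M}_\tau,\mathcal{N}_\tau:\mathbb{C}\to\mathbf{Set}$ be the presheaves of simply typed $\lambda$-terms (with unit, pairs and functions, up to renaming of bound variables), neutral terms and normal terms of type $\tau$, with action by renaming; here neutral terms $M$ and normal terms (long $\beta\eta$-normal forms) $N$ are given by mutual induction: variables are neutral; $\pi_i(M)$ and $M(N)$ are neutral; $\langle\rangle$, $\langle N_1,N_2\rangle$ and $\lambda x.N$ are normal; and a neutral term of base type is normal. Let $s:T\to\mathcal{S}$ be an interpretation of base types in a cartesian closed category, with its induced interpretation $s[\![-]\!]$ of types, contexts and terms. Let $\mathcal{G}_s$ be the cartesian closed glueing category of triples $(P,\;p:P\to\mathcal{S}(s[\![-]\!],A),\;A)$ with $P:\mathbb{C}\to\mathbf{Set}$ and $A\in\mathcal{S}$; write $\bar y(\Gamma)=(\mathbb{C}(\Gamma,-),\,s[\![-]\!],\,s[\![\Gamma]\!])$,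 and let $V_\tau$, $\mu_\tau$, $\nu_\tau$ be the glued objects over $s[\![\tau]\!]$ of variables, neutral terms and normal terms of type $\tau$ with their semantics. Let $\bar s:T\to\mathcal{G}_s$, $\theta\mapsto\mu_\theta$, and let $\mu_\tau\xrightarrow{u_\tau}\bar s[\![\tau]\!]\xrightarrow{q_\tau}\nu_\tau$ be the unquote and quote maps, defined by induction on $\tau$: - $u_\theta=\mathrm{id}$ and $q_\theta$ is the identification of neutral and normal terms of base type; - $u_1$ is the unique map and $q_1=(\mathsf{unit},\mathrm{id})$; - $u_{\tau*\tau'}=\langle u_\tau\circ(\mathsf{fst},\pi_1),\,u_{\tau'}\circ(\mathsf{snd},\pi_2)\rangle$ and $q_{\tau*\tau'}=(\mathsf{pair},\mathrm{id})\circ(q_\tau\times q_{\tau'})$; - $u_{\tau\Rightarrow\tau'}$ is the exponential transpose of $u_{\tau'}\circ(\mathsf{app},\varepsilon)\circ(\mathrm{id}\times q_\tau)$, and $q_{\tau\Rightarrow\tau'}=(\mathsf{abs},\mathrm{id})\circ q_{\tau'}^{\,u_\tau v_\tau}$, where $v_\tau=(\mathsf{var},\mathrm{id}):V_\tau\to\mu_\tau$.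 The normalisation function induced by $s$ is the natural transformation $\mathrm{nf}^s_\tau:\mathcal{L}_\tau\to\mathcal{N}_\tau$ sending $t\in\mathcal{L}_\tau(\Gamma)$ to the value at $\mathrm{id}_\Gamma$ of the presheaf component of $$\bar y(\Gamma)\to\prod_{(x:\sigma)\in\Gamma}\mu_\sigma\xrightarrow{\prod u_\sigma}\bar s[\![\Gamma]\!]\xrightarrow{\bar s[\![t]\!]}\bar s[\![\tau]\!]\xrightarrow{q_\tau}\nu_\tau ,$$ where the first map tuples the variables of $\Gamma$. Let $f:T\to\mathcal{F}_{\mathrm{ccc}}[T]$ be the universal interpretation in the free cartesian closed category on $T$. Corollary. For every interpretation $s:T\to\mathcal{S}$ of base types in a cartesian closed category and every type $\tau$, $$\mathrm{nf}^s_\tau=\mathrm{nf}^f_\tau:\mathcal{L}_\tau\to\mathcal{N}_\tau\quad\text{in }\mathbf{Set}^{\mathbb{C}}.$$ Consequently all interpretations induce one and the same normalisation function, and for every term $t\in\mathcal{L}_\tau(\Gamma)$ its value $\mathrm{nf}^f_\tau(t)$ is the unique normal term in $\mathcal{N}_\tau(\Gamma)$ that is $\beta\eta$-equal to $t$. -/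

import Mathlib

open CategoryTheory MonoidalCategory CartesianMonoidalCategory Opposite

universe u v w

namespace NbE

/-! ### Syntax of the simply typed lambda calculus -/

/-- Simple types over a set `T` of base types. -/
inductive Ty (T : Type u) : Type u
  | base : T → Ty T
  | unit : Ty T
  | prod : Ty T → Ty T → Ty T
  | arr : Ty T → Ty T → Ty T

/-- Typing contexts, generated from the empty context by context extension. -/
inductive Ctx (T : Type u) : Type u
  | nil : Ctx T
  | ext : Ctx T → Ty T → Ctx T

/-- `Var Γ τ` is the set of variables (de Bruijn indices) declared with type `τ` in `Γ`. -/
inductive Var {T : Type u} : Ctx T → Ty T → Type u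
  | zero {Γ : Ctx T} {τ : Ty T} : Var (Γ.ext τ) τ
  | succ {Γ : Ctx T} {τ σ : Ty T} : Var Γ τ → Var (Γ.ext σ) τ

/-- Type-preserving context renamings. -/
@[ext]
structure Ren {T : Type u} (Γ Δ : Ctx T) : Type u where
  app : ∀ {τ : Ty T}, Var Γ τ → Var Δ τ

/-- The category of contexts and type-preserving renamings. -/
instance Ctx.category (T : Type u) : SmallCategory (Ctx T) where
  Hom := Ren
  id _ := ⟨fun x => x⟩
  comp ρ ρ' := ⟨fun x => ρ'.app (ρ.app x)⟩

section Terms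

variable {T : Type u}

/-- The renaming `Γ → Γ, x : σ`. -/
def Ren.wk (Γ : Ctx T) (σ : Ty T) : Γ ⟶ Γ.ext σ := ⟨Var.succ⟩

/-- A function on the variables of `Γ` extended to the variables of `Γ, x : σ`. -/
def liftVar {Γ Δ : Ctx T} (σ : Ty T) (ρ : Γ ⟶ Δ) :
    ∀ {τ : Ty T}, Var (Γ.ext σ) τ → Var (Δ.ext σ) τ
  | _, .zero => .zero
  | _, .succ x => .succ (ρ.app x)

/-- The renaming `Γ, x : σ → Δ, x : σ` induced by a renaming `Γ → Δ`. -/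
def Ren.lift {Γ Δ : Ctx T} (σ : Ty T) (ρ : Γ ⟶ Δ) : Γ.ext σ ⟶ Δ.ext σ := ⟨liftVar σ ρ⟩

/-- `Tm Γ τ` is the set of terms of type `τ` in context `Γ` (up to renaming of bound variables). -/
inductive Tm : Ctx T → Ty T → Type u
  | var {Γ : Ctx T} {τ : Ty T} : Var Γ τ → Tm Γ τ
  | unit {Γ : Ctx T} : Tm Γ .unit
  | fst {Γ : Ctx T} {σ τ : Ty T} : Tm Γ (.prod σ τ) → Tm Γ σ
  | snd {Γ : Ctx T} {σ τ : Ty T} : Tm Γ (.prod σ τ) → Tm Γ τ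
  | pair {Γ : Ctx T} {σ τ : Ty T} : Tm Γ σ → Tm Γ τ → Tm Γ (.prod σ τ)
  | app {Γ : Ctx T} {σ τ : Ty T} : Tm Γ (.arr σ τ) → Tm Γ σ → Tm Γ τ
  | lam {Γ : Ctx T} {σ τ : Ty T} : Tm (Γ.ext σ) τ → Tm Γ (.arr σ τ)

namespace Tm

/-- The action of a renaming on terms. -/
def rename {Γ Δ : Ctx T} {τ : Ty T} (ρ : Γ ⟶ Δ) : Tm Γ τ → Tm Δ τ
  | var x => var (ρ.app x)
  | unit => unit
  | fst t => fst (rename ρ t)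
  | snd t => snd (rename ρ t)
  | pair t t' => pair (rename ρ t) (rename ρ t')
  | app t t' => app (rename ρ t) (rename ρ t')
  | lam t => lam (rename (Ren.lift _ ρ) t)

/-- A simultaneous substitution extended under a binder. -/
def liftSub {Γ Δ : Ctx T} (σ : Ty T) (θ : ∀ τ : Ty T, Var Γ τ → Tm Δ τ) :
    ∀ τ : Ty T, Var (Γ.ext σ) τ → Tm (Δ.ext σ) τ
  | _, .zero => var .zero
  | _, .succ x => rename (Ren.wk Δ σ) (θ _ x)

/-- Simultaneous (capture-avoiding) substitution. -/
def subst {Γ Δ : Ctx T} {τ : Ty T} (θ : ∀ τ : Ty T, Var Γ τ → Tm Δ τ) : Tm Γ τ → Tm Δ τ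
  | var x => θ _ x
  | unit => unit
  | fst t => fst (subst θ t)
  | snd t => snd (subst θ t)
  | pair t t' => pair (subst θ t) (subst θ t')
  | app t t' => app (subst θ t) (subst θ t')
  | lam t => lam (subst (liftSub _ θ) t)

/-- The substitution sending the last variable to `a` and fixing the others. -/
def single {Γ : Ctx T} {σ : Ty T} (a : Tm Γ σ) : ∀ τ : Ty T, Var (Γ.ext σ) τ → Tm Γ τ
  | _, .zero => a
  | _, .succ x => var x

end Tm

/-- `βη`-equality of terms. -/
inductive BetaEta : ∀ {Γ : Ctx T} {τ : Ty T}, Tm Γ τ → Tm Γ τ → Prop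
  | refl {Γ : Ctx T} {τ : Ty T} (t : Tm Γ τ) : BetaEta t t
  | symm {Γ : Ctx T} {τ : Ty T} {t t' : Tm Γ τ} : BetaEta t t' → BetaEta t' t
  | trans {Γ : Ctx T} {τ : Ty T} {t t' t'' : Tm Γ τ} :
      BetaEta t t' → BetaEta t' t'' → BetaEta t t''
  | fst_congr {Γ : Ctx T} {σ τ : Ty T} {t t' : Tm Γ (.prod σ τ)} :
      BetaEta t t' → BetaEta t.fst t'.fst
  | snd_congr {Γ : Ctx T} {σ τ : Ty T} {t t' : Tm Γ (.prod σ τ)} :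
      BetaEta t t' → BetaEta t.snd t'.snd
  | pair_congr {Γ : Ctx T} {σ τ : Ty T} {a a' : Tm Γ σ} {b b' : Tm Γ τ} :
      BetaEta a a' → BetaEta b b' → BetaEta (a.pair b) (a'.pair b')
  | app_congr {Γ : Ctx T} {σ τ : Ty T} {t t' : Tm Γ (.arr σ τ)} {a a' : Tm Γ σ} :
      BetaEta t t' → BetaEta a a' → BetaEta (t.app a) (t'.app a')
  | lam_congr {Γ : Ctx T} {σ τ : Ty T} {t t' : Tm (Γ.ext σ) τ} :
      BetaEta t t' → BetaEta t.lam t'.lam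
  | beta_fst {Γ : Ctx T} {σ τ : Ty T} (a : Tm Γ σ) (b : Tm Γ τ) : BetaEta (a.pair b).fst a
  | beta_snd {Γ : Ctx T} {σ τ : Ty T} (a : Tm Γ σ) (b : Tm Γ τ) : BetaEta (a.pair b).snd b
  | beta_app {Γ : Ctx T} {σ τ : Ty T} (t : Tm (Γ.ext σ) τ) (a : Tm Γ σ) :
      BetaEta (t.lam.app a) (t.subst (Tm.single a))
  | eta_unit {Γ : Ctx T} (t : Tm Γ .unit) : BetaEta t .unit
  | eta_pair {Γ : Ctx T} {σ τ : Ty T} (t : Tm Γ (.prod σ τ)) : BetaEta t (t.fst.pair t.snd)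
  | eta_lam {Γ : Ctx T} {σ τ : Ty T} (t : Tm Γ (.arr σ τ)) :
      BetaEta t ((t.rename (Ren.wk Γ σ)).app (.var .zero)).lam

mutual

/-- Neutral terms. -/
inductive IsNeutral : ∀ {Γ : Ctx T} {τ : Ty T}, Tm Γ τ → Prop
  | var {Γ : Ctx T} {τ : Ty T} (x : Var Γ τ) : IsNeutral (.var x)
  | fst {Γ : Ctx T} {σ τ : Ty T} {M : Tm Γ (.prod σ τ)} : IsNeutral M → IsNeutral M.fst
  | snd {Γ : Ctx T} {σ τ : Ty T} {M : Tm Γ (.prod σ τ)} : IsNeutral M → IsNeutral M.snd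
  | app {Γ : Ctx T} {σ τ : Ty T} {M : Tm Γ (.arr σ τ)} {N : Tm Γ σ} :
      IsNeutral M → IsNormal N → IsNeutral (M.app N)

/-- Normal terms, i.e. long `βη`-normal forms. -/
inductive IsNormal : ∀ {Γ : Ctx T} {τ : Ty T}, Tm Γ τ → Prop
  | unit {Γ : Ctx T} : IsNormal (.unit (Γ := Γ))
  | pair {Γ : Ctx T} {σ τ : Ty T} {N : Tm Γ σ} {N' : Tm Γ τ} :
      IsNormal N → IsNormal N' → IsNormal (N.pair N')
  | lam {Γ : Ctx T} {σ τ : Ty T} {N : Tm (Γ.ext σ) τ} : IsNormal N → IsNormal N.lam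
  | base {Γ : Ctx T} {b : T} {M : Tm Γ (.base b)} : IsNeutral M → IsNormal M

end

theorem Ren.lift_id {Γ : Ctx T} (σ : Ty T) : Ren.lift σ (𝟙 Γ) = 𝟙 (Γ.ext σ) := by
  apply Ren.ext
  funext τ x
  cases x <;> rfl

theorem Ren.lift_comp {Γ Δ Θ : Ctx T} (σ : Ty T) (ρ : Γ ⟶ Δ) (ρ' : Δ ⟶ Θ) :
    Ren.lift σ (ρ ≫ ρ') = Ren.lift σ ρ ≫ Ren.lift σ ρ' := by
  apply Ren.ext
  funext τ x
  cases x <;> rfl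

theorem Ren.wk_lift {Γ Δ : Ctx T} (σ : Ty T) (ρ : Γ ⟶ Δ) :
    Ren.wk Γ σ ≫ Ren.lift σ ρ = ρ ≫ Ren.wk Δ σ := rfl

theorem Tm.rename_id {Γ : Ctx T} {τ : Ty T} (t : Tm Γ τ) : t.rename (𝟙 Γ) = t := by
  induction t with
  | var x => rfl
  | unit => rfl
  | fst t ih => simp only [rename, ih]
  | snd t ih => simp only [rename, ih]
  | pair t t' ih ih' => simp only [rename, ih, ih']
  | app t t' ih ih' => simp only [rename, ih, ih']
  | lam t ih => simp only [rename, Ren.lift_id, ih]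

theorem Tm.rename_comp {Γ Δ Θ : Ctx T} {τ : Ty T} (t : Tm Γ τ) (ρ : Γ ⟶ Δ) (ρ' : Δ ⟶ Θ) :
    t.rename (ρ ≫ ρ') = (t.rename ρ).rename ρ' := by
  induction t generalizing Δ Θ with
  | var x => rfl
  | unit => rfl
  | fst t ih => simp only [rename, ih]
  | snd t ih => simp only [rename, ih]
  | pair t t' ih ih' => simp only [rename, ih, ih']
  | app t t' ih ih' => simp only [rename, ih, ih']
  | lam t ih => simp only [rename, Ren.lift_comp, ih]

mutual

theorem IsNeutral.rename {Γ Δ : Ctx T} {τ : Ty T} {t : Tm Γ τ} (ρ : Γ ⟶ Δ) :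
    IsNeutral t → IsNeutral (t.rename ρ)
  | .var x => .var _
  | .fst h => .fst (h.rename ρ)
  | .snd h => .snd (h.rename ρ)
  | .app h h' => .app (h.rename ρ) (h'.rename ρ)

theorem IsNormal.rename {Γ Δ : Ctx T} {τ : Ty T} {t : Tm Γ τ} (ρ : Γ ⟶ Δ) :
    IsNormal t → IsNormal (t.rename ρ)
  | .unit => .unit
  | .pair h h' => .pair (h.rename ρ) (h'.rename ρ)
  | .lam h => .lam (h.rename (Ren.lift _ ρ))
  | .base h => .base (h.rename ρ)

end

/-- Neutral terms of type `τ` in context `Γ`. -/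
def Ne (Γ : Ctx T) (τ : Ty T) : Type u := {t : Tm Γ τ // IsNeutral t}

/-- Normal terms of type `τ` in context `Γ`. -/
def Nf (Γ : Ctx T) (τ : Ty T) : Type u := {t : Tm Γ τ // IsNormal t}

/-- The presheaf of variables of type `τ`. -/
def varPsh (τ : Ty T) : Ctx T ⥤ Type u where
  obj Γ := Var Γ τ
  map ρ := ↾fun x => ρ.app x

/-- The presheaf of terms of type `τ`, with action given by variable renaming. -/
def tmPsh (τ : Ty T) : Ctx T ⥤ Type u where
  obj Γ := Tm Γ τ
  map ρ := ↾fun t => t.rename ρ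
  map_id Γ := by ext t; exact t.rename_id
  map_comp ρ ρ' := by ext t; exact t.rename_comp ρ ρ'

/-- The presheaf of neutral terms of type `τ`. -/
def nePsh (τ : Ty T) : Ctx T ⥤ Type u where
  obj Γ := Ne Γ τ
  map ρ := ↾fun M => ⟨M.1.rename ρ, M.2.rename ρ⟩
  map_id Γ := by ext M; exact Subtype.ext M.1.rename_id
  map_comp ρ ρ' := by ext M; exact Subtype.ext (M.1.rename_comp ρ ρ')

/-- The presheaf of normal terms of type `τ`. -/
def nfPsh (τ : Ty T) : Ctx T ⥤ Type u where
  obj Γ := Nf Γ τ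
  map ρ := ↾fun N => ⟨N.1.rename ρ, N.2.rename ρ⟩
  map_id Γ := by ext N; exact Subtype.ext N.1.rename_id
  map_comp ρ ρ' := by ext N; exact Subtype.ext (N.1.rename_comp ρ ρ')

end Terms

/-! ### Semantics in cartesian closed categories -/

section Semantics

variable {T : Type u} {C : Type w} [Category.{v} C] [CartesianMonoidalCategory C]

/-- The product `∏_{(x : τ) ∈ Γ} D τ` of a type-indexed family of objects over a context. -/
@[reducible]
def ctxProd (D : Ty T → C) : Ctx T → C
  | .nil => 𝟙_ C
  | .ext Γ τ => D τ ⊗ ctxProd D Γ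

/-- The projection of `∏_{(x : τ) ∈ Γ} D τ` at a variable. -/
def ctxProj (D : Ty T → C) : ∀ {Γ : Ctx T} {τ : Ty T}, Var Γ τ → (ctxProd D Γ ⟶ D τ)
  | _, _, .zero => fst _ _
  | _, _, .succ x => snd _ _ ≫ ctxProj D x

/-- The tupling of a family of morphisms indexed by the variables of a context. -/
def ctxLift (D : Ty T → C) {X : C} :
    ∀ {Γ : Ctx T}, (∀ τ : Ty T, Var Γ τ → (X ⟶ D τ)) → (X ⟶ ctxProd D Γ)
  | .nil, _ => toUnit X
  | .ext _ _, g => lift (g _ .zero) (ctxLift D fun τ x => g τ (.succ x))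

/-- The product over a context of a type-indexed family of morphisms. -/
def ctxMap {D E : Ty T → C} (g : ∀ τ : Ty T, D τ ⟶ E τ) (Γ : Ctx T) :
    ctxProd D Γ ⟶ ctxProd E Γ :=
  ctxLift E fun τ x => ctxProj D x ≫ g τ

/-- The contravariant action of renamings on products over contexts. -/
def ctxRen (D : Ty T → C) {Γ Δ : Ctx T} (ρ : Γ ⟶ Δ) : ctxProd D Δ ⟶ ctxProd D Γ :=
  ctxLift D fun _ x => ctxProj D (ρ.app x)

theorem ctxLift_proj (D : Ty T → C) {X : C} {Γ : Ctx T}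
    (g : ∀ τ : Ty T, Var Γ τ → (X ⟶ D τ)) {τ : Ty T} (x : Var Γ τ) :
    ctxLift D g ≫ ctxProj D x = g τ x := by
  induction x with
  | zero => simp [ctxLift, ctxProj]
  | succ x ih => simp [ctxLift, ctxProj, ih]

theorem ctxRen_proj (D : Ty T → C) {Γ Δ : Ctx T} (ρ : Γ ⟶ Δ) {τ : Ty T} (x : Var Γ τ) :
    ctxRen D ρ ≫ ctxProj D x = ctxProj D (ρ.app x) :=
  ctxLift_proj D _ x

theorem ctxProd_hom_ext (D : Ty T → C) {X : C} {Γ : Ctx T} {f g : X ⟶ ctxProd D Γ}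
    (h : ∀ (τ : Ty T) (x : Var Γ τ), f ≫ ctxProj D x = g ≫ ctxProj D x) : f = g := by
  induction Γ with
  | nil => exact toUnit_unique _ _
  | ext Γ σ ih =>
    apply CartesianMonoidalCategory.hom_ext
    · exact h σ .zero
    · apply ih
      intro τ x
      simpa [ctxProj] using h τ (.succ x)

/-- Products over contexts and the action of renamings on them, as a functor. -/
def ctxFunctor (D : Ty T → C) : (Ctx T)ᵒᵖ ⥤ C where
  obj Γ := ctxProd D Γ.unop
  map ρ := ctxRen D ρ.unop
  map_id Γ := by
    apply ctxProd_hom_ext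
    intro τ x
    rw [ctxRen_proj, Category.id_comp]
    rfl
  map_comp ρ ρ' := by
    apply ctxProd_hom_ext
    intro τ x
    rw [Category.assoc, ctxRen_proj, ctxRen_proj, ctxRen_proj]
    rfl

theorem ctxRen_wk (D : Ty T → C) (Γ : Ctx T) (σ : Ty T) :
    ctxRen D (Ren.wk Γ σ) = snd (D σ) (ctxProd D Γ) := by
  apply ctxProd_hom_ext
  intro τ x
  rw [ctxRen_proj]
  rfl

theorem ctxRen_lift (D : Ty T → C) {Γ Δ : Ctx T} (σ : Ty T) (ρ : Γ ⟶ Δ) :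
    ctxRen D (Ren.lift σ ρ) = D σ ◁ ctxRen D ρ := by
  apply ctxProd_hom_ext
  intro τ x
  rw [ctxRen_proj]
  cases x with
  | zero => simp [Ren.lift, liftVar, ctxProj]
  | succ x => simp [Ren.lift, liftVar, ctxProj, ctxRen_proj]

variable [MonoidalClosed C]

/-- The extension of an interpretation `s` of base types to simple types. -/
@[reducible]
def tySem (s : T → C) : Ty T → C
  | .base b => s b
  | .unit => 𝟙_ C
  | .prod σ τ => tySem s σ ⊗ tySem s τ
  | .arr σ τ => (ihom (tySem s σ)).obj (tySem s τ)

/-- The functor interpreting contexts and their renamings. -/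
abbrev ctxSem (s : T → C) : (Ctx T)ᵒᵖ ⥤ C := ctxFunctor (tySem s)

/-- The interpretation of a term `Γ ⊢ t : τ` as a morphism from `Γ` to `τ`. -/
def tmSem (s : T → C) : ∀ {Γ : Ctx T} {τ : Ty T}, Tm Γ τ → (ctxProd (tySem s) Γ ⟶ tySem s τ)
  | _, _, .var x => ctxProj (tySem s) x
  | _, _, .unit => toUnit _
  | _, _, .fst t => tmSem s t ≫ fst _ _
  | _, _, .snd t => tmSem s t ≫ snd _ _
  | _, _, .pair t t' => lift (tmSem s t) (tmSem s t')
  | _, _, .app t t' => lift (tmSem s t') (tmSem s t) ≫ (ihom.ev _).app _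
  | _, _, .lam t => MonoidalClosed.curry (tmSem s t)

theorem tmSem_rename (s : T → C) {Γ Δ : Ctx T} {τ : Ty T} (t : Tm Γ τ) (ρ : Γ ⟶ Δ) :
    tmSem s (t.rename ρ) = ctxRen (tySem s) ρ ≫ tmSem s t := by
  induction t generalizing Δ with
  | var x => exact (ctxRen_proj _ ρ x).symm
  | unit => exact toUnit_unique _ _
  | fst t ih => simp only [Tm.rename, tmSem, ih, Category.assoc]
  | snd t ih => simp only [Tm.rename, tmSem, ih, Category.assoc]
  | pair t t' ih ih' => simp only [Tm.rename, tmSem, ih, ih', comp_lift]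
  | app t t' ih ih' => simp only [Tm.rename, tmSem, ih, ih', comp_lift_assoc]
  | lam t ih =>
    simp only [Tm.rename, tmSem, ih, ctxRen_lift]
    exact MonoidalClosed.curry_natural_left _ _

end Semantics

/-! ### The free cartesian closed category on a set -/

section Free

/-- Formal arrows between simple types, generated by the operations of a cartesian closed
category. -/
inductive Arr {T : Type u} : Ty T → Ty T → Type u
  | id (A : Ty T) : Arr A A
  | comp {A B C : Ty T} : Arr A B → Arr B C → Arr A C
  | toUnit (A : Ty T) : Arr A .unit
  | fst (A B : Ty T) : Arr (.prod A B) A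
  | snd (A B : Ty T) : Arr (.prod A B) B
  | lift {X A B : Ty T} : Arr X A → Arr X B → Arr X (.prod A B)
  | curry {X A B : Ty T} : Arr (.prod A X) B → Arr X (.arr A B)
  | ev (A B : Ty T) : Arr (.prod A (.arr A B)) B

/-- The congruence on formal arrows generated by the equations of cartesian closed categories. -/
inductive ArrEq {T : Type u} : ∀ {A B : Ty T}, Arr A B → Arr A B → Prop
  | refl {A B : Ty T} (f : Arr A B) : ArrEq f f
  | symm {A B : Ty T} {f g : Arr A B} : ArrEq f g → ArrEq g f
  | trans {A B : Ty T} {f g h : Arr A B} : ArrEq f g → ArrEq g h → ArrEq f h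
  | comp_congr {A B C : Ty T} {f f' : Arr A B} {g g' : Arr B C} :
      ArrEq f f' → ArrEq g g' → ArrEq (f.comp g) (f'.comp g')
  | lift_congr {X A B : Ty T} {f f' : Arr X A} {g g' : Arr X B} :
      ArrEq f f' → ArrEq g g' → ArrEq (f.lift g) (f'.lift g')
  | curry_congr {X A B : Ty T} {f f' : Arr (.prod A X) B} :
      ArrEq f f' → ArrEq f.curry f'.curry
  | id_comp {A B : Ty T} (f : Arr A B) : ArrEq ((Arr.id A).comp f) f
  | comp_id {A B : Ty T} (f : Arr A B) : ArrEq (f.comp (.id B)) f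
  | assoc {A B C D : Ty T} (f : Arr A B) (g : Arr B C) (h : Arr C D) :
      ArrEq ((f.comp g).comp h) (f.comp (g.comp h))
  | toUnit_uniq {A : Ty T} (f : Arr A .unit) : ArrEq f (.toUnit A)
  | lift_fst {X A B : Ty T} (f : Arr X A) (g : Arr X B) : ArrEq ((f.lift g).comp (.fst A B)) f
  | lift_snd {X A B : Ty T} (f : Arr X A) (g : Arr X B) : ArrEq ((f.lift g).comp (.snd A B)) g
  | lift_uniq {X A B : Ty T} (h : Arr X (.prod A B)) :
      ArrEq ((h.comp (.fst A B)).lift (h.comp (.snd A B))) h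
  | curry_ev {X A B : Ty T} (f : Arr (.prod A X) B) :
      ArrEq (((Arr.fst A X).lift ((Arr.snd A X).comp f.curry)).comp (.ev A B)) f
  | curry_uniq {X A B : Ty T} (g : Arr X (.arr A B)) :
      ArrEq (Arr.curry (((Arr.fst A X).lift ((Arr.snd A X).comp g)).comp (.ev A B))) g

/-- Formal arrows modulo the equations of cartesian closed categories. -/
def arrSetoid {T : Type u} (A B : Ty T) : Setoid (Arr A B) where
  r := ArrEq
  iseqv := ⟨.refl, .symm, .trans⟩

/-- The free cartesian closed category on the set `T`: its objects are the simple types over `T`,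
and its morphisms are formal arrows modulo the equations of cartesian closed categories. -/
structure FreeCCC (T : Type u) : Type u where
  ty : Ty T

namespace FreeCCC

variable {T : Type u}

instance : SmallCategory (FreeCCC T) where
  Hom A B := Quotient (arrSetoid A.ty B.ty)
  id A := Quotient.mk _ (.id A.ty)
  comp f g := Quotient.map₂ Arr.comp (fun _ _ h _ _ h' => ArrEq.comp_congr h h') f g
  id_comp f := by
    induction f using Quotient.ind
    exact Quotient.sound (ArrEq.id_comp _)
  comp_id f := by
    induction f using Quotient.ind
    exact Quotient.sound (ArrEq.comp_id _)
  assoc f g h := by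
    induction f using Quotient.ind
    induction g using Quotient.ind
    induction h using Quotient.ind
    exact Quotient.sound (ArrEq.assoc _ _ _)

/-- The morphism represented by a formal arrow. -/
def homMk {A B : FreeCCC T} (f : Arr A.ty B.ty) : A ⟶ B := Quotient.mk _ f

/-- The terminal object. -/
abbrev one : FreeCCC T := ⟨.unit⟩

/-- Binary products. -/
abbrev prod (A B : FreeCCC T) : FreeCCC T := ⟨.prod A.ty B.ty⟩

/-- Exponentials. -/
abbrev exp (A B : FreeCCC T) : FreeCCC T := ⟨.arr A.ty B.ty⟩

/-- First projection. -/
def prodFst (A B : FreeCCC T) : prod A B ⟶ A := homMk (.fst _ _)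

/-- Second projection. -/
def prodSnd (A B : FreeCCC T) : prod A B ⟶ B := homMk (.snd _ _)

/-- Pairing. -/
def prodLift {X A B : FreeCCC T} (f : X ⟶ A) (g : X ⟶ B) : X ⟶ prod A B :=
  Quotient.map₂ (sa := arrSetoid X.ty A.ty) (sb := arrSetoid X.ty B.ty)
    (sc := arrSetoid X.ty (.prod A.ty B.ty)) Arr.lift
    (fun _ _ h _ _ h' => ArrEq.lift_congr h h') f g

theorem prodLift_fst {X A B : FreeCCC T} (f : X ⟶ A) (g : X ⟶ B) :
    prodLift f g ≫ prodFst A B = f := by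
  induction f using Quotient.ind
  induction g using Quotient.ind
  exact Quotient.sound (ArrEq.lift_fst _ _)

theorem prodLift_snd {X A B : FreeCCC T} (f : X ⟶ A) (g : X ⟶ B) :
    prodLift f g ≫ prodSnd A B = g := by
  induction f using Quotient.ind
  induction g using Quotient.ind
  exact Quotient.sound (ArrEq.lift_snd _ _)

theorem prodLift_uniq {X A B : FreeCCC T} (h : X ⟶ prod A B) :
    prodLift (h ≫ prodFst A B) (h ≫ prodSnd A B) = h := by
  induction h using Quotient.ind
  exact Quotient.sound (ArrEq.lift_uniq _)

/-- The cartesian structure of the free cartesian closed category. -/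
instance : CartesianMonoidalCategory (FreeCCC T) :=
  .ofChosenFiniteProducts
    ⟨Limits.asEmptyCone one, Limits.IsTerminal.ofUniqueHom (fun A => homMk (.toUnit A.ty))
      fun A f => by
        induction f using Quotient.ind
        exact Quotient.sound (ArrEq.toUnit_uniq _)⟩
    fun A B => ⟨Limits.BinaryFan.mk (prodFst A B) (prodSnd A B),
      Limits.BinaryFan.IsLimit.mk _ (fun f g => prodLift f g) prodLift_fst prodLift_snd
        fun f g m hf hg => by
          subst hf hg
          exact (prodLift_uniq m).symm⟩

/-- Evaluation. -/
def expEv (A B : FreeCCC T) : A ⊗ exp A B ⟶ B := homMk (.ev A.ty B.ty)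

/-- Transposition. -/
def expCurry {X A B : FreeCCC T} (f : A ⊗ X ⟶ B) : X ⟶ exp A B :=
  Quotient.map (sa := arrSetoid (.prod A.ty X.ty) B.ty) (sb := arrSetoid X.ty (.arr A.ty B.ty))
    Arr.curry (fun _ _ h => ArrEq.curry_congr h) f

theorem lift_eq {X A B : FreeCCC T} (f : X ⟶ A) (g : X ⟶ B) :
    CartesianMonoidalCategory.lift f g = prodLift f g := rfl

theorem whiskerLeft_eq (A : FreeCCC T) {X Y : FreeCCC T} (f : X ⟶ Y) :
    A ◁ f = prodLift (fst A X) (snd A X ≫ f) := by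
  rw [← lift_eq]
  apply CartesianMonoidalCategory.hom_ext <;> simp

theorem expCurry_ev {X A B : FreeCCC T} (f : A ⊗ X ⟶ B) : A ◁ expCurry f ≫ expEv A B = f := by
  rw [whiskerLeft_eq]
  induction f using Quotient.ind
  exact Quotient.sound (ArrEq.curry_ev _)

theorem expCurry_uniq {X A B : FreeCCC T} (g : X ⟶ exp A B) :
    expCurry (A ◁ g ≫ expEv A B) = g := by
  rw [whiskerLeft_eq]
  induction g using Quotient.ind
  exact Quotient.sound (ArrEq.curry_uniq _)

/-- Morphisms `A ⊗ X ⟶ B` correspond to morphisms `X ⟶ exp A B`. -/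
def expEquiv (A X B : FreeCCC T) : ((tensorLeft A).obj X ⟶ B) ≃ (X ⟶ exp A B) where
  toFun f := expCurry f
  invFun g := A ◁ g ≫ expEv A B
  left_inv := expCurry_ev
  right_inv := expCurry_uniq

theorem expEquiv_naturality (A X' X B : FreeCCC T) (f : X' ⟶ X) (g : (tensorLeft A).obj X ⟶ B) :
    expEquiv A X' B ((tensorLeft A).map f ≫ g) = f ≫ expEquiv A X B g := by
  apply (expEquiv A X' B).symm.injective
  rw [Equiv.symm_apply_apply]
  change A ◁ f ≫ g = A ◁ (f ≫ expCurry g) ≫ expEv A B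
  rw [MonoidalCategory.whiskerLeft_comp, Category.assoc, expCurry_ev]

/-- The free cartesian closed category is cartesian closed. -/
instance : MonoidalClosed (FreeCCC T) where
  closed A :=
    { rightAdj := Adjunction.rightAdjointOfEquiv (F := tensorLeft A) (expEquiv A)
        (expEquiv_naturality A)
      adj := Adjunction.adjunctionOfEquivRight (F := tensorLeft A) (expEquiv A)
        (expEquiv_naturality A) }

/-- The universal interpretation of base types in the free cartesian closed category. -/
def of (b : T) : FreeCCC T := ⟨.base b⟩

end FreeCCC

end Free

/-! ### Glueing along the nerve functor -/

section Glueing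

variable {K : Type u} [SmallCategory K] {S : Type w} [Category.{v} S]

/-- Objects `(P, p, A)` of the glueing category along the nerve functor
`A ↦ Hom (ς (-), A)` induced by `ς : Kᵒᵖ ⥤ S`: a (covariant) presheaf `P` on `K`, an object `A`
of `S` and a natural transformation `p : P ⟶ Hom (ς (-), A)`. -/
structure Glue (ς : Kᵒᵖ ⥤ S) where
  P : K ⥤ Type (max u v)
  A : S
  p : ∀ c : K, P.obj c → (ς.obj (op c) ⟶ A)
  p_map : ∀ {c d : K} (ρ : c ⟶ d) (a : P.obj c), p d (P.map ρ a) = ς.map ρ.op ≫ p c a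

namespace Glue

/-- Morphisms of glued objects: pairs `(φ, f)` making the evident square commute. -/
@[ext]
structure Hom {ς : Kᵒᵖ ⥤ S} (X Y : Glue ς) where
  φ : X.P ⟶ Y.P
  f : X.A ⟶ Y.A
  comm : ∀ (c : K) (a : X.P.obj c), Y.p c (φ.app c a) = X.p c a ≫ f

/-- The glueing category. -/
instance (ς : Kᵒᵖ ⥤ S) : Category (Glue ς) where
  Hom := Hom
  id X := ⟨𝟙 X.P, 𝟙 X.A, fun c a => (Category.comp_id _).symm⟩
  comp g h := ⟨g.φ ≫ h.φ, g.f ≫ h.f, fun c a => by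
    rw [← Category.assoc, ← g.comm]
    exact h.comm c _⟩
  id_comp g := Hom.ext (Category.id_comp _) (Category.id_comp _)
  comp_id g := Hom.ext (Category.comp_id _) (Category.comp_id _)
  assoc g h k := Hom.ext (Category.assoc _ _ _) (Category.assoc _ _ _)

variable {ς : Kᵒᵖ ⥤ S}

theorem hom_ext {X Y : Glue ς} {g h : X ⟶ Y}
    (h₁ : ∀ (c : K) (a : X.P.obj c), g.φ.app c a = h.φ.app c a) (h₂ : g.f = h.f) : g = h := by
  apply Hom.ext _ h₂
  ext c a
  exact h₁ c a

theorem map_id_apply (X : Glue ς) (c : K) (a : X.P.obj c) : X.P.map (𝟙 c) a = a := by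
  rw [X.P.map_id]
  rfl

theorem map_comp_apply (X : Glue ς) {c d e : K} (ρ : c ⟶ d) (ρ' : d ⟶ e) (a : X.P.obj c) :
    X.P.map (ρ ≫ ρ') a = X.P.map ρ' (X.P.map ρ a) := by
  rw [X.P.map_comp]
  rfl

theorem φ_map {X Y : Glue ς} (g : X ⟶ Y) {c d : K} (ρ : c ⟶ d) (a : X.P.obj c) :
    g.φ.app d (X.P.map ρ a) = Y.P.map ρ (g.φ.app c a) :=
  ConcreteCategory.congr_hom (g.φ.naturality ρ) a

variable [CartesianMonoidalCategory S]

/-- The terminal glued object. -/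
def one (ς : Kᵒᵖ ⥤ S) : Glue ς where
  P := (Functor.const K).obj PUnit
  A := 𝟙_ S
  p _ _ := toUnit _
  p_map _ _ := toUnit_unique _ _

/-- The product of two glued objects. -/
def prod (X Y : Glue ς) : Glue ς where
  P :=
    { obj := fun c => X.P.obj c × Y.P.obj c
      map := fun ρ => ↾fun a => (X.P.map ρ a.1, Y.P.map ρ a.2)
      map_id := fun c => by
        ext a
        · exact X.map_id_apply c a.1
        · exact Y.map_id_apply c a.2
      map_comp := fun ρ ρ' => by
        ext a
        · exact X.map_comp_apply ρ ρ' a.1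
        · exact Y.map_comp_apply ρ ρ' a.2 }
  A := X.A ⊗ Y.A
  p c a := lift (X.p c a.1) (Y.p c a.2)
  p_map ρ a := by
    rw [comp_lift, ← X.p_map, ← Y.p_map]
    rfl

/-- First projection. -/
def prodFst (X Y : Glue ς) : prod X Y ⟶ X where
  φ := { app := fun c => ↾fun a => a.1 }
  f := fst _ _
  comm _ _ := (lift_fst _ _).symm

/-- Second projection. -/
def prodSnd (X Y : Glue ς) : prod X Y ⟶ Y where
  φ := { app := fun c => ↾fun a => a.2 }
  f := snd _ _
  comm _ _ := (lift_snd _ _).symm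

/-- Pairing. -/
def prodLift {Z X Y : Glue ς} (g : Z ⟶ X) (h : Z ⟶ Y) : Z ⟶ prod X Y where
  φ :=
    { app := fun c => ↾fun a => (g.φ.app c a, h.φ.app c a)
      naturality := fun c d ρ => by
        ext a
        exact Prod.ext (φ_map g ρ a) (φ_map h ρ a) }
  f := lift g.f h.f
  comm c a := by
    refine Eq.trans ?_ (comp_lift (Z.p c a) g.f h.f).symm
    rw [← g.comm, ← h.comm]
    rfl

/-- The unique map to the terminal glued object. -/
def toOne (X : Glue ς) : X ⟶ one ς where
  φ := { app := fun c => ↾fun _ => PUnit.unit }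
  f := toUnit _
  comm _ _ := toUnit_unique _ _

/-- The cartesian structure of the glueing category. -/
instance : CartesianMonoidalCategory (Glue ς) :=
  .ofChosenFiniteProducts
    ⟨Limits.asEmptyCone (one ς), Limits.IsTerminal.ofUniqueHom toOne
      fun X g => hom_ext (fun _ _ => rfl) (toUnit_unique _ _)⟩
    fun X Y => ⟨Limits.BinaryFan.mk (prodFst X Y) (prodSnd X Y),
      Limits.BinaryFan.IsLimit.mk _ (fun f g => prodLift f g)
        (fun g h => hom_ext (fun _ _ => rfl) (lift_fst _ _))
        (fun g h => hom_ext (fun _ _ => rfl) (lift_snd _ _))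
        fun g h m hg hh => by
          subst hg hh
          exact hom_ext (fun _ _ => rfl) (lift_comp_fst_snd _).symm⟩

theorem whiskerLeft_eq (X : Glue ς) {Y Z : Glue ς} (g : Y ⟶ Z) :
    X ◁ g = prodLift (prodFst X Y) (prodSnd X Y ≫ g) :=
  CartesianMonoidalCategory.hom_ext _ _
    ((whiskerLeft_fst X g).trans (lift_fst (prodFst X Y) (prodSnd X Y ≫ g)).symm)
    ((whiskerLeft_snd X g).trans (lift_snd (prodFst X Y) (prodSnd X Y ≫ g)).symm)

variable [MonoidalClosed S]

theorem lift_curry_ev {W' W A B : S} (a : W' ⟶ A) (b : W' ⟶ W) (g : A ⊗ W ⟶ B) :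
    lift a (b ≫ MonoidalClosed.curry g) ≫ (ihom.ev A).app B = lift a b ≫ g := by
  rw [← lift_whiskerLeft, Category.assoc, MonoidalClosed.whiskerLeft_curry_ihom_ev_app]

theorem curry_lift_ev {W A B : S} (h : W ⟶ (ihom A).obj B) :
    MonoidalClosed.curry (lift (fst A W) (snd A W ≫ h) ≫ (ihom.ev A).app B) = h := by
  rw [← lift_whiskerLeft, lift_fst_snd, Category.id_comp, ← MonoidalClosed.uncurry_eq,
    MonoidalClosed.curry_uncurry]

/-- Elements at stage `c` of the exponential of the glued objects `X` and `Y`: pairs of a morphism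
`f : ς c ⟶ (X.A ⟹ Y.A)` and a natural transformation `φ : y c × X.P ⟶ Y.P` lying over it. -/
@[ext]
structure ExpEl (X Y : Glue ς) (c : K) : Type (max u v) where
  f : ς.obj (op c) ⟶ (ihom X.A).obj Y.A
  φ : ∀ d : K, (c ⟶ d) → X.P.obj d → Y.P.obj d
  φ_map : ∀ {d e : K} (ρ : c ⟶ d) (ρ' : d ⟶ e) (a : X.P.obj d),
    φ e (ρ ≫ ρ') (X.P.map ρ' a) = Y.P.map ρ' (φ d ρ a)
  comm : ∀ (d : K) (ρ : c ⟶ d) (a : X.P.obj d),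
    Y.p d (φ d ρ a) = lift (X.p d a) (ς.map ρ.op ≫ f) ≫ (ihom.ev X.A).app Y.A

/-- The presheaf action on exponentials. -/
def ExpEl.map {X Y : Glue ς} {c d : K} (σ : c ⟶ d) (r : ExpEl X Y c) : ExpEl X Y d where
  f := ς.map σ.op ≫ r.f
  φ e ρ a := r.φ e (σ ≫ ρ) a
  φ_map ρ ρ' a := by rw [← Category.assoc, r.φ_map]
  comm e ρ a := by rw [r.comm, op_comp, ς.map_comp, Category.assoc]

theorem ExpEl.map_id {X Y : Glue ς} {c : K} (r : ExpEl X Y c) : r.map (𝟙 c) = r := by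
  refine ExpEl.ext ?_ ?_
  · simp [ExpEl.map]
  · simp [ExpEl.map]

theorem ExpEl.map_comp {X Y : Glue ς} {c d e : K} (σ : c ⟶ d) (σ' : d ⟶ e) (r : ExpEl X Y c) :
    r.map (σ ≫ σ') = (r.map σ).map σ' := by
  refine ExpEl.ext ?_ ?_
  · simp [ExpEl.map]
  · simp [ExpEl.map]

/-- The exponential of two glued objects. -/
def exp (X Y : Glue ς) : Glue ς where
  P :=
    { obj := fun c => ExpEl X Y c
      map := fun σ => TypeCat.ofHom (ExpEl.map σ)
      map_id := fun _ => ConcreteCategory.hom_ext _ _ ExpEl.map_id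
      map_comp := fun σ σ' => ConcreteCategory.hom_ext _ _ (ExpEl.map_comp σ σ') }
  A := (ihom X.A).obj Y.A
  p _ r := r.f
  p_map _ _ := rfl

/-- Evaluation. -/
def expEv (X Y : Glue ς) : X ⊗ exp X Y ⟶ Y where
  φ :=
    { app := fun c => ↾fun (a : X.P.obj c × ExpEl X Y c) => a.2.φ c (𝟙 c) a.1
      naturality := fun c d ρ => by
        ext (a : X.P.obj c × ExpEl X Y c)
        change a.2.φ d (ρ ≫ 𝟙 d) (X.P.map ρ a.1) = Y.P.map ρ (a.2.φ c (𝟙 c) a.1)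
        rw [← a.2.φ_map, Category.comp_id, Category.id_comp] }
  f := (ihom.ev X.A).app Y.A
  comm c a := by
    refine (ExpEl.comm _ c (𝟙 c) _).trans ?_
    rw [op_id, ς.map_id, Category.id_comp]
    rfl

/-- Transposition. -/
def expCurry {Z X Y : Glue ς} (g : X ⊗ Z ⟶ Y) : Z ⟶ exp X Y where
  φ :=
    { app := fun c => ↾fun z =>
        { f := Z.p c z ≫ MonoidalClosed.curry g.f
          φ := fun d ρ a => g.φ.app d (show X.P.obj d × Z.P.obj d from (a, Z.P.map ρ z))
          φ_map := fun {d e} ρ ρ' a => by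
            refine Eq.trans ?_ (φ_map g ρ' (show X.P.obj d × Z.P.obj d from (a, Z.P.map ρ z)))
            rw [Z.map_comp_apply]
            rfl
          comm := fun d ρ a => by
            refine (g.comm d (show X.P.obj d × Z.P.obj d from (a, Z.P.map ρ z))).trans ?_
            change lift (X.p d a) (Z.p d (Z.P.map ρ z)) ≫ g.f = _
            rw [Z.p_map, ← Category.assoc (ς.map ρ.op)]
            exact (lift_curry_ev _ _ _).symm }
      naturality := fun c d σ => by
        ext z
        refine ExpEl.ext ?_ ?_
        · change Z.p d (Z.P.map σ z) ≫ _ = ς.map σ.op ≫ Z.p c z ≫ _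
          rw [Z.p_map, Category.assoc]
        · funext e ρ a
          change g.φ.app e (show X.P.obj e × Z.P.obj e from (a, Z.P.map ρ (Z.P.map σ z))) =
            g.φ.app e (show X.P.obj e × Z.P.obj e from (a, Z.P.map (σ ≫ ρ) z))
          rw [Z.map_comp_apply] }
  f := MonoidalClosed.curry g.f
  comm _ _ := rfl

theorem expCurry_ev {Z X Y : Glue ς} (g : X ⊗ Z ⟶ Y) : X ◁ expCurry g ≫ expEv X Y = g := by
  rw [whiskerLeft_eq]
  refine hom_ext ?_ ?_
  · intro c a
    change g.φ.app c (show X.P.obj c × Z.P.obj c from (a.1, Z.P.map (𝟙 c) a.2)) = g.φ.app c a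
    rw [Z.map_id_apply]
    rfl
  · change lift (fst X.A Z.A) (snd X.A Z.A ≫ MonoidalClosed.curry g.f) ≫
      (ihom.ev X.A).app Y.A = g.f
    refine (lift_curry_ev _ _ _).trans ?_
    rw [lift_fst_snd]
    exact Category.id_comp _

theorem expCurry_uniq {Z X Y : Glue ς} (h : Z ⟶ exp X Y) : expCurry (X ◁ h ≫ expEv X Y) = h := by
  rw [whiskerLeft_eq]
  have hf : (expCurry (prodLift (prodFst X Z) (prodSnd X Z ≫ h) ≫ expEv X Y)).f  = h.f :=
    curry_lift_ev (A := X.A) (B := Y.A) h.f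
  refine hom_ext ?_ hf
  intro c z
  refine ExpEl.ext ?_ ?_
  · refine Eq.trans ?_ (h.comm c z).symm
    rw [← hf]
    rfl
  · funext d ρ a
    change (h.φ.app d (Z.P.map ρ z)).φ d (𝟙 d) a = (h.φ.app c z).φ d ρ a
    rw [φ_map]
    change (h.φ.app c z).φ d (ρ ≫ 𝟙 d) a = _
    rw [Category.comp_id]

/-- Morphisms `X ⊗ Z ⟶ Y` correspond to morphisms `Z ⟶ exp X Y`. -/
def expEquiv (X Z Y : Glue ς) : ((tensorLeft X).obj Z ⟶ Y) ≃ (Z ⟶ exp X Y) where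
  toFun g := expCurry g
  invFun h := X ◁ h ≫ expEv X Y
  left_inv := expCurry_ev
  right_inv := expCurry_uniq

theorem expEquiv_naturality (X Z' Z Y : Glue ς) (g : Z' ⟶ Z) (h : (tensorLeft X).obj Z ⟶ Y) :
    expEquiv X Z' Y ((tensorLeft X).map g ≫ h) = g ≫ expEquiv X Z Y h := by
  apply (expEquiv X Z' Y).symm.injective
  rw [Equiv.symm_apply_apply]
  change X ◁ g ≫ h = X ◁ (g ≫ expCurry h) ≫ expEv X Y
  rw [MonoidalCategory.whiskerLeft_comp, Category.assoc, expCurry_ev]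

/-- The glueing category is cartesian closed. -/
instance : MonoidalClosed (Glue ς) where
  closed X :=
    { rightAdj := Adjunction.rightAdjointOfEquiv (F := tensorLeft X) (expEquiv X)
        (expEquiv_naturality X)
      adj := Adjunction.adjunctionOfEquivRight (F := tensorLeft X) (expEquiv X)
        (expEquiv_naturality X) }

end Glue

end Glueing

/-! ### Normalisation by evaluation -/

section Normalisation

variable {T : Type u} {S : Type w} [Category.{v} S] [CartesianMonoidalCategory S]
  [MonoidalClosed S]

/-- The glueing category along the nerve of the interpretation of contexts induced by `s`. -/
abbrev GlueCat (s : T → S) : Type (max (u + 1) (v + 1) w) := Glue (ctxSem s)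

/-- The embedding of contexts in the glueing category, on objects:
the representable presheaf on `Γ` over the interpretation of `Γ`. -/
def yonObj (s : T → S) (Γ : Ctx T) : GlueCat s where
  P := coyoneda.obj (op Γ) ⋙ uliftFunctor.{v}
  A := ctxProd (tySem s) Γ
  p _ ρ := (ctxSem s).map ρ.down.op
  p_map ρ ρ' := (ctxSem s).map_comp ρ.op ρ'.down.op

/-- The glued object of variables of type `τ`. -/
def varObj (s : T → S) (τ : Ty T) : GlueCat s where
  P := varPsh τ ⋙ uliftFunctor.{v}
  A := tySem s τ
  p _ x := ctxProj (tySem s) x.down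
  p_map ρ x := (ctxRen_proj (tySem s) ρ x.down).symm

/-- The glued object of neutral terms of type `τ` and their semantics. -/
def neObj (s : T → S) (τ : Ty T) : GlueCat s where
  P := nePsh τ ⋙ uliftFunctor.{v}
  A := tySem s τ
  p _ M := tmSem s M.down.1
  p_map ρ M := tmSem_rename s M.down.1 ρ

/-- The glued object of normal terms of type `τ` and their semantics. -/
def nfObj (s : T → S) (τ : Ty T) : GlueCat s where
  P := nfPsh τ ⋙ uliftFunctor.{v}
  A := tySem s τ
  p _ N := tmSem s N.down.1
  p_map ρ N := tmSem_rename s N.down.1 ρ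

/-- `(var, id)`, from variables to neutral terms. -/
def varMap (s : T → S) (τ : Ty T) : varObj s τ ⟶ neObj s τ where
  φ := { app := fun Γ => ↾fun x => ⟨⟨.var x.down, .var _⟩⟩ }
  f := 𝟙 (tySem s τ)
  comm _ _ := (Category.comp_id _).symm

/-- `(fst, π₁)` on neutral terms. -/
def fstMap (s : T → S) (σ τ : Ty T) : neObj s (.prod σ τ) ⟶ neObj s σ where
  φ := { app := fun Γ => ↾fun M => ⟨⟨.fst M.down.1, .fst M.down.2⟩⟩ }
  f := fst (tySem s σ) (tySem s τ)
  comm _ _ := rfl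

/-- `(snd, π₂)` on neutral terms. -/
def sndMap (s : T → S) (σ τ : Ty T) : neObj s (.prod σ τ) ⟶ neObj s τ where
  φ := { app := fun Γ => ↾fun M => ⟨⟨.snd M.down.1, .snd M.down.2⟩⟩ }
  f := snd (tySem s σ) (tySem s τ)
  comm _ _ := rfl

/-- `(app, ε)`, applying neutral terms to normal terms. -/
def appMap (s : T → S) (σ τ : Ty T) : nfObj s σ ⊗ neObj s (.arr σ τ) ⟶ neObj s τ where
  φ :=
    { app := fun Γ => ↾fun (a : ULift.{v} (Nf Γ σ) × ULift.{v} (Ne Γ (.arr σ τ))) =>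
        ⟨⟨.app a.2.down.1 a.1.down.1, .app a.2.down.2 a.1.down.2⟩⟩ }
  f := (ihom.ev (tySem s σ)).app (tySem s τ)
  comm _ _ := rfl

/-- Neutral terms of base type are normal. -/
def normMap (s : T → S) (b : T) : neObj s (.base b) ⟶ nfObj s (.base b) where
  φ := { app := fun Γ => ↾fun M => ⟨⟨M.down.1, .base M.down.2⟩⟩ }
  f := 𝟙 (s b)
  comm _ _ := (Category.comp_id _).symm

/-- `(unit, id)` on normal terms. -/
def unitMap (s : T → S) : 𝟙_ (GlueCat s) ⟶ nfObj s .unit where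
  φ := { app := fun Γ => ↾fun _ => ⟨⟨.unit, .unit⟩⟩ }
  f := 𝟙 (𝟙_ S)
  comm _ _ := toUnit_unique _ _

/-- `(pair, id)` on normal terms. -/
def pairMap (s : T → S) (σ τ : Ty T) : nfObj s σ ⊗ nfObj s τ ⟶ nfObj s (.prod σ τ) where
  φ :=
    { app := fun Γ => ↾fun (a : ULift.{v} (Nf Γ σ) × ULift.{v} (Nf Γ τ)) =>
        ⟨⟨.pair a.1.down.1 a.2.down.1, .pair a.1.down.2 a.2.down.2⟩⟩ }
  f := 𝟙 (tySem s σ ⊗ tySem s τ)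
  comm _ _ := (Category.comp_id _).symm

/-- The element of `nfPsh τ` in the context `Γ, x : σ` that represents an element at stage `Γ` of
the exponential of `nfObj s τ` by `varObj s σ`, obtained by evaluation at the fresh variable. -/
def expBody (s : T → S) {σ τ : Ty T} {Γ : Ctx T} (r : Glue.ExpEl (varObj s σ) (nfObj s τ) Γ) :
    Nf (Γ.ext σ) τ :=
  (r.φ (Γ.ext σ) (Ren.wk Γ σ) ⟨Var.zero⟩).down

/-- `(abs, id)`, from the exponential of normal terms by variables to normal terms. -/
def absMap (s : T → S) (σ τ : Ty T) :
    (ihom (varObj s σ)).obj (nfObj s τ) ⟶ nfObj s (.arr σ τ) where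
  φ :=
    { app := fun Γ => ↾fun (r : Glue.ExpEl (varObj s σ) (nfObj s τ) Γ) =>
        ⟨⟨.lam (expBody s r).1, .lam (expBody s r).2⟩⟩
      naturality := fun Γ Δ ρ => by
        ext (r : Glue.ExpEl (varObj s σ) (nfObj s τ) Γ)
        apply congrArg ULift.up
        apply Subtype.ext
        apply congrArg Tm.lam
        have h := r.φ_map (Ren.wk Γ σ) (Ren.lift σ ρ) ⟨Var.zero⟩
        exact congrArg (fun N => N.down.1) h }
  f := 𝟙 ((ihom (tySem s σ)).obj (tySem s τ))
  comm Γ (r : Glue.ExpEl (varObj s σ) (nfObj s τ) Γ) := by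
    refine Eq.trans ?_ (Category.comp_id _).symm
    refine Eq.trans ?_ (Glue.curry_lift_ev (A := tySem s σ) (B := tySem s τ) r.f)
    apply congrArg MonoidalClosed.curry
    refine (r.comm (Γ.ext σ) (Ren.wk Γ σ) ⟨Var.zero⟩).trans ?_
    change lift (fst _ _) (ctxRen (tySem s) (Ren.wk Γ σ) ≫ r.f) ≫ _ = _
    rw [ctxRen_wk]
    rfl

/-- The interpretation of base types in the glueing category by neutral terms. -/
def glueInterp (s : T → S) (b : T) : GlueCat s := neObj s (.base b)

/-- The unquote and quote maps. -/
def unquoteQuote (s : T → S) : ∀ τ : Ty T,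
    (neObj s τ ⟶ tySem (glueInterp s) τ) × (tySem (glueInterp s) τ ⟶ nfObj s τ)
  | .base b => (𝟙 (neObj s (.base b)), normMap s b)
  | .unit => (toUnit _, unitMap s)
  | .prod σ τ =>
      (lift (fstMap s σ τ ≫ (unquoteQuote s σ).1) (sndMap s σ τ ≫ (unquoteQuote s τ).1),
       ((unquoteQuote s σ).2 ⊗ₘ (unquoteQuote s τ).2) ≫ pairMap s σ τ)
  | .arr σ τ =>
      (MonoidalClosed.curry
        ((unquoteQuote s σ).2 ▷ neObj s (.arr σ τ) ≫ appMap s σ τ ≫ (unquoteQuote s τ).1),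
       (MonoidalClosed.pre (varMap s σ ≫ (unquoteQuote s σ).1)).app _ ≫
         (ihom (varObj s σ)).map (unquoteQuote s τ).2 ≫ absMap s σ τ)

/-- The unquote map. -/
def unquote (s : T → S) (τ : Ty T) : neObj s τ ⟶ tySem (glueInterp s) τ := (unquoteQuote s τ).1

/-- The quote map. -/
def quote (s : T → S) (τ : Ty T) : tySem (glueInterp s) τ ⟶ nfObj s τ := (unquoteQuote s τ).2

/-- The map from the glued representable on `Γ` to variables of type `τ` given by a variable. -/
def yonProj (s : T → S) {Γ : Ctx T} {τ : Ty T} (x : Var Γ τ) : yonObj s Γ ⟶ varObj s τ where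
  φ := { app := fun Δ => ↾fun ρ => ⟨ρ.down.app x⟩ }
  f := ctxProj (tySem s) x
  comm _ ρ := (ctxRen_proj (tySem s) ρ.down x).symm

/-- The map from the glued representable on `Γ` to the product of neutral terms over `Γ`. -/
def varCtx (s : T → S) (Γ : Ctx T) : yonObj s Γ ⟶ ctxProd (neObj s) Γ :=
  ctxLift (varObj s) (fun _ x => yonProj s x) ≫ ctxMap (varMap s) Γ

/-- The unquote map on contexts. -/
def unquoteCtx (s : T → S) (Γ : Ctx T) :
    ctxProd (neObj s) Γ ⟶ ctxProd (tySem (glueInterp s)) Γ :=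
  ctxMap (unquote s) Γ

/-- The morphism `quote ∘ ⟦t⟧ ∘ unquote ∘ var` in the glueing category. -/
def nfHom (s : T → S) {Γ : Ctx T} {τ : Ty T} (t : Tm Γ τ) : yonObj s Γ ⟶ nfObj s τ :=
  varCtx s Γ ≫ unquoteCtx s Γ ≫ tmSem (glueInterp s) t ≫ quote s τ

/-- The functorial action of the embedding of contexts in the glueing category. -/
def yonMap (s : T → S) {Γ Δ : Ctx T} (ρ : Γ ⟶ Δ) : yonObj s Δ ⟶ yonObj s Γ where
  φ := { app := fun Θ => ↾fun ρ' => ⟨ρ ≫ ρ'.down⟩ }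
  f := ctxRen (tySem s) ρ
  comm _ ρ' := (ctxSem s).map_comp ρ'.down.op ρ.op

theorem yonMap_yonProj (s : T → S) {Γ Δ : Ctx T} (ρ : Γ ⟶ Δ) {τ : Ty T} (x : Var Γ τ) :
    yonMap s ρ ≫ yonProj s x = yonProj s (ρ.app x) :=
  Glue.hom_ext (fun _ _ => rfl) (ctxRen_proj _ ρ x)

theorem varCtx_unquoteCtx_proj (s : T → S) {Γ : Ctx T} {τ : Ty T} (x : Var Γ τ) :
    (varCtx s Γ ≫ unquoteCtx s Γ) ≫ ctxProj (tySem (glueInterp s)) x =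
      yonProj s x ≫ varMap s τ ≫ unquote s τ := by
  rw [Category.assoc, unquoteCtx, ctxMap, ctxLift_proj, varCtx, ctxMap, Category.assoc,
    ← Category.assoc (ctxLift (neObj s) _), ctxLift_proj, Category.assoc, ← Category.assoc,
    ctxLift_proj]

theorem nfHom_rename (s : T → S) {Γ Δ : Ctx T} {τ : Ty T} (ρ : Γ ⟶ Δ) (t : Tm Γ τ) :
    nfHom s (t.rename ρ) = yonMap s ρ ≫ nfHom s t := by
  have h : (varCtx s Δ ≫ unquoteCtx s Δ) ≫ ctxRen (tySem (glueInterp s)) ρ =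
      yonMap s ρ ≫ varCtx s Γ ≫ unquoteCtx s Γ := by
    apply ctxProd_hom_ext
    intro τ x
    rw [Category.assoc, ctxRen_proj, varCtx_unquoteCtx_proj, Category.assoc,
      varCtx_unquoteCtx_proj, ← Category.assoc (yonMap s ρ), yonMap_yonProj]
  rw [nfHom, nfHom, tmSem_rename, ← Category.assoc, Category.assoc (ctxRen _ ρ),
    ← Category.assoc _ (ctxRen _ ρ), h]
  simp only [Category.assoc]

/-- The value of a glued morphism out of the representable on `Γ` at the identity of `Γ`. -/
def evalId (s : T → S) {Γ : Ctx T} {τ : Ty T} (g : yonObj s Γ ⟶ nfObj s τ) : Nf Γ τ :=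
  (g.φ.app Γ ⟨𝟙 Γ⟩).down

theorem evalId_yonMap (s : T → S) {Γ Δ : Ctx T} {τ : Ty T} (ρ : Γ ⟶ Δ)
    (g : yonObj s Γ ⟶ nfObj s τ) :
    evalId s (yonMap s ρ ≫ g) = (nfPsh τ).map ρ (evalId s g) := by
  have h := congrArg ULift.down (Glue.φ_map g ρ ⟨𝟙 Γ⟩)
  refine Eq.trans ?_ h
  change (g.φ.app Δ ⟨ρ ≫ 𝟙 Δ⟩).down = (g.φ.app Δ ⟨𝟙 Γ ≫ ρ⟩).down
  rw [Category.comp_id, Category.id_comp]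

/-- The normalisation function induced by an interpretation `s` of base types in a cartesian
closed category, as a morphism of presheaves: it sends a term `t` in context `Γ` to the value at
the identity of `Γ` of the presheaf component of `quote ∘ ⟦t⟧ ∘ unquote ∘ var`. -/
def nf (s : T → S) (τ : Ty T) : tmPsh τ ⟶ nfPsh τ where
  app Γ := ↾fun t => evalId s (nfHom s t)
  naturality Γ Δ ρ := by
    ext t
    exact (congrArg (evalId s) (nfHom_rename s ρ t)).trans (evalId_yonMap s ρ (nfHom s t))

/-- The normal term that the normalisation function induced by `s` assigns to a term. -/
def normalise (s : T → S) {Γ : Ctx T} {τ : Ty T} (t : Tm Γ τ) : Nf Γ τ := (nf s τ).app Γ t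

end Normalisation

end NbE

/-!
Whatever the interpretation `s`, a term and its normal form are tied together by the presheaf
components of the glued objects alone. Evaluating a neutral term in the environment of unquoted
variables gives back its unquoting, so normal terms are fixed by normalisation, and soundness of the
glued interpretation makes normalisation invariant under `βη`-equality. Conversely, a Kripke logical
relation between terms and elements of the glued types, with `βη`-equality at base types, contains
every neutral term paired with its unquoting and forces related terms to be `βη`-equal to what the
related element quotes to; hence `t` is `βη`-equal to its normal form. So for every `s` the normal
form of `t` is the only normal term `βη`-equal to `t`, a description in which `s` does not occur.
-/

namespace NbE

/-! ### Substitution -/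

section Substitution

variable {T : Type u} {Γ Δ Θ : Ctx T} {σ τ : Ty T}

/-- Simultaneous substitutions of terms in context `Δ` for the variables of `Γ`. -/
abbrev Subst (Γ Δ : Ctx T) : Type u := ∀ τ : Ty T, Var Γ τ → Tm Δ τ

/-- The extension of a simultaneous substitution by a term for the last variable. -/
def Subst.cons (a : Tm Δ σ) (θ : Subst Γ Δ) : Subst (Γ.ext σ) Δ
  | _, .zero => a
  | _, .succ x => θ _ x

namespace Tm

theorem liftSub_var :
    liftSub σ (fun _ x => var x : Subst Γ Γ) = (fun _ x => var x : Subst (Γ.ext σ) (Γ.ext σ)) := by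
  funext τ x
  cases x <;> rfl

theorem liftSub_app_lift (ρ : Γ ⟶ Δ) (θ : Subst Δ Θ) :
    (fun τ x => liftSub σ θ τ ((Ren.lift σ ρ).app x)) = liftSub σ fun τ x => θ τ (ρ.app x) := by
  funext τ x
  cases x <;> rfl

theorem rename_lift_liftSub (θ : Subst Γ Δ) (ρ : Δ ⟶ Θ) :
    (fun τ x => (liftSub σ θ τ x).rename (Ren.lift σ ρ)) =
      liftSub σ fun τ x => (θ τ x).rename ρ := by
  funext τ x
  cases x with
  | zero => rfl
  | succ x => simp only [liftSub, ← rename_comp, Ren.wk_lift]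

theorem subst_var (t : Tm Γ τ) : t.subst (fun _ x => var x) = t := by
  induction t <;> simp only [subst, liftSub_var, *]

theorem subst_rename (t : Tm Γ τ) (ρ : Γ ⟶ Δ) (θ : Subst Δ Θ) :
    (t.rename ρ).subst θ = t.subst fun τ x => θ τ (ρ.app x) := by
  induction t generalizing Δ Θ <;> simp only [rename, subst, liftSub_app_lift, *]

theorem rename_subst (t : Tm Γ τ) (θ : Subst Γ Δ) (ρ : Δ ⟶ Θ) :
    (t.subst θ).rename ρ = t.subst fun τ x => (θ τ x).rename ρ := by
  induction t generalizing Δ Θ <;> simp only [rename, subst, rename_lift_liftSub, *]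

theorem subst_liftSub_liftSub (θ : Subst Γ Δ) (θ' : Subst Δ Θ) :
    (fun τ x => (liftSub σ θ τ x).subst (liftSub σ θ')) =
      liftSub σ fun τ x => (θ τ x).subst θ' := by
  funext τ x
  cases x with
  | zero => rfl
  | succ x =>
    simp only [liftSub, subst_rename, rename_subst]
    rfl

theorem subst_subst (t : Tm Γ τ) (θ : Subst Γ Δ) (θ' : Subst Δ Θ) :
    (t.subst θ).subst θ' = t.subst fun τ x => (θ τ x).subst θ' := by
  induction t generalizing Δ Θ <;> simp only [subst, subst_liftSub_liftSub, *]

theorem rename_subst_single (t : Tm (Γ.ext σ) τ) (a : Tm Γ σ) (ρ : Γ ⟶ Δ) :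
    (t.subst (single a)).rename ρ = (t.rename (Ren.lift σ ρ)).subst (single (a.rename ρ)) := by
  rw [rename_subst, subst_rename]
  congr 1
  funext τ x
  cases x <;> rfl

theorem subst_liftSub_single (t : Tm (Γ.ext σ) τ) (θ : Subst Γ Δ) (a : Tm Δ σ) :
    (t.subst (liftSub σ θ)).subst (single a) = t.subst (θ.cons a) := by
  rw [subst_subst]
  congr 1
  funext τ x
  cases x with
  | zero => rfl
  | succ x => exact (subst_rename _ _ _).trans (subst_var _)

end Tm

theorem BetaEta.rename {t t' : Tm Γ τ} (h : BetaEta t t') (ρ : Γ ⟶ Δ) :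
    BetaEta (t.rename ρ) (t'.rename ρ) := by
  induction h generalizing Δ with
  | refl => exact .refl _
  | symm _ ih => exact .symm (ih ρ)
  | trans _ _ ih ih' => exact .trans (ih ρ) (ih' ρ)
  | fst_congr _ ih => exact .fst_congr (ih ρ)
  | snd_congr _ ih => exact .snd_congr (ih ρ)
  | pair_congr _ _ ih ih' => exact .pair_congr (ih ρ) (ih' ρ)
  | app_congr _ _ ih ih' => exact .app_congr (ih ρ) (ih' ρ)
  | lam_congr _ ih => exact .lam_congr (ih _)
  | beta_fst => exact .beta_fst _ _
  | beta_snd => exact .beta_snd _ _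
  | beta_app t a =>
    rw [Tm.rename_subst_single]
    exact .beta_app _ _
  | eta_unit => exact .eta_unit _
  | eta_pair => exact .eta_pair _
  | eta_lam t =>
    have h := BetaEta.eta_lam (t.rename ρ)
    rwa [← Tm.rename_comp, ← Ren.wk_lift, Tm.rename_comp] at h

end Substitution

/-! ### Soundness of the interpretation -/

section Soundness

variable {T : Type u} {C : Type w} [Category.{v} C] [CartesianMonoidalCategory C]

theorem ctxLift_ctxProj (D : Ty T → C) (Γ : Ctx T) :
    ctxLift D (fun _ x => ctxProj D x) = 𝟙 (ctxProd D Γ) := by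
  apply ctxProd_hom_ext
  intro τ x
  rw [ctxLift_proj, Category.id_comp]

variable [MonoidalClosed C] (s : T → C) {Γ Δ : Ctx T} {σ τ : Ty T}

/-- The interpretation of a simultaneous substitution as a morphism between contexts. -/
def substSem (θ : Subst Γ Δ) : ctxProd (tySem s) Δ ⟶ ctxProd (tySem s) Γ :=
  ctxLift (tySem s) fun τ x => tmSem s (θ τ x)

theorem substSem_proj (θ : Subst Γ Δ) (x : Var Γ τ) :
    substSem s θ ≫ ctxProj (tySem s) x = tmSem s (θ τ x) :=
  ctxLift_proj (tySem s) _ x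

theorem substSem_liftSub (θ : Subst Γ Δ) :
    substSem s (Tm.liftSub σ θ) = tySem s σ ◁ substSem s θ := by
  apply ctxProd_hom_ext
  intro τ x
  rw [substSem_proj]
  cases x with
  | zero => simp only [Tm.liftSub, tmSem, ctxProj, whiskerLeft_fst]
  | succ x =>
    simp only [Tm.liftSub, tmSem_rename, ctxRen_wk, ctxProj, whiskerLeft_snd_assoc, substSem_proj]

theorem substSem_single (a : Tm Γ σ) :
    substSem s (Tm.single a) = lift (tmSem s a) (𝟙 (ctxProd (tySem s) Γ)) :=
  congrArg (lift (tmSem s a)) (ctxLift_ctxProj (tySem s) Γ)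

theorem tmSem_subst (t : Tm Γ τ) (θ : Subst Γ Δ) :
    tmSem s (t.subst θ) = substSem s θ ≫ tmSem s t := by
  induction t generalizing Δ with
  | var x => exact (substSem_proj s θ x).symm
  | unit => exact toUnit_unique _ _
  | fst t ih => simp only [Tm.subst, tmSem, ih, Category.assoc]
  | snd t ih => simp only [Tm.subst, tmSem, ih, Category.assoc]
  | pair t t' ih ih' => simp only [Tm.subst, tmSem, ih, ih', comp_lift]
  | app t t' ih ih' => simp only [Tm.subst, tmSem, ih, ih', comp_lift_assoc]
  | lam t ih =>
    simp only [Tm.subst, tmSem, ih, substSem_liftSub]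
    exact MonoidalClosed.curry_natural_left _ _

theorem BetaEta.tmSem_eq {t t' : Tm Γ τ} (h : BetaEta t t') : tmSem s t = tmSem s t' := by
  induction h with
  | refl => rfl
  | symm _ ih => exact ih.symm
  | trans _ _ ih ih' => exact ih.trans ih'
  | fst_congr _ ih => simp only [tmSem, ih]
  | snd_congr _ ih => simp only [tmSem, ih]
  | pair_congr _ _ ih ih' => simp only [tmSem, ih, ih']
  | app_congr _ _ ih ih' => simp only [tmSem, ih, ih']
  | lam_congr _ ih => simp only [tmSem, ih]
  | beta_fst => exact lift_fst _ _
  | beta_snd => exact lift_snd _ _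
  | beta_app t a =>
    rw [tmSem_subst, substSem_single, ← Glue.lift_curry_ev, Category.id_comp]
    rfl
  | eta_unit => exact toUnit_unique _ _
  | eta_pair => exact (lift_comp_fst_snd _).symm
  | eta_lam t =>
    simp only [tmSem, tmSem_rename, ctxRen_wk, ctxProj]
    exact (Glue.curry_lift_ev _).symm

end Soundness

/-! ### Elements of glued objects -/

namespace Glue

variable {K : Type u} [SmallCategory K] {S : Type w} [Category.{v} S] {ς : Kᵒᵖ ⥤ S}

/-- The action of a morphism of `K` on the elements of the presheaf of a glued object. -/
def act {X : Glue ς} {c d : K} (ρ : c ⟶ d) (a : X.P.obj c) : X.P.obj d := X.P.map ρ a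

variable [CartesianMonoidalCategory S]

/-- The element of a product of glued objects given by a pair of elements. -/
def pairEl {X Y : Glue ς} {c : K} (a : X.P.obj c) (b : Y.P.obj c) : (X ⊗ Y).P.obj c := (a, b)

theorem ctxProd_el_ext {T : Type u} (D : Ty T → Glue ς) {Γ : Ctx T} {c : K}
    {a b : (ctxProd D Γ).P.obj c}
    (h : ∀ (τ : Ty T) (x : Var Γ τ), (ctxProj D x).φ.app c a = (ctxProj D x).φ.app c b) :
    a = b := by
  induction Γ with
  | nil => rfl
  | ext Γ σ ih => exact Prod.ext (h σ .zero) (ih fun τ x => h τ (.succ x))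

variable [MonoidalClosed S] {X X' Y Y' Z : Glue ς} {c d : K}

theorem ihom_ev_app_eq_expEv (X Y : Glue ς) : (ihom.ev X).app Y = expEv X Y := by
  change X ◁ 𝟙 (exp X Y) ≫ expEv X Y = expEv X Y
  rw [MonoidalCategory.whiskerLeft_id, Category.id_comp]

theorem curry_eq_expCurry (g : X ⊗ Z ⟶ Y) : MonoidalClosed.curry g = expCurry g := by
  refine ((MonoidalClosed.eq_curry_iff g (expCurry g)).2 ?_).symm
  refine (MonoidalClosed.uncurry_eq (A := X) _).trans ?_
  rw [ihom_ev_app_eq_expEv]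
  exact expCurry_ev g

/-- The application of an element of an exponential of glued objects at a later stage. -/
def expApp (r : ((ihom X).obj Y).P.obj c) (ρ : c ⟶ d) (a : X.P.obj d) : Y.P.obj d :=
  ExpEl.φ (X := X) (Y := Y) r d ρ a

theorem expApp_curry (g : X ⊗ Z ⟶ Y) (z : Z.P.obj c) (ρ : c ⟶ d) (a : X.P.obj d) :
    expApp ((MonoidalClosed.curry g).φ.app c z) ρ a = g.φ.app d (pairEl a (act ρ z)) := by
  rw [curry_eq_expCurry]
  rfl

theorem expApp_act {e : K} (r : ((ihom X).obj Y).P.obj c) (ρ : c ⟶ d) (ρ' : d ⟶ e)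
    (a : X.P.obj e) : expApp (act ρ r) ρ' a = expApp r (ρ ≫ ρ') a :=
  rfl

theorem ev_pairEl (a : X.P.obj c) (r : ((ihom X).obj Y).P.obj c) :
    ((ihom.ev X).app Y).φ.app c (pairEl a r) = expApp r (𝟙 c) a := by
  rw [ihom_ev_app_eq_expEv]
  rfl

theorem ev_pairEl_act (r : ((ihom X).obj Y).P.obj c) (ρ : c ⟶ d) (a : X.P.obj d) :
    ((ihom.ev X).app Y).φ.app d (pairEl a (act ρ r)) = expApp r ρ a := by
  rw [ev_pairEl, expApp_act, Category.comp_id]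

theorem expApp_pre (g : X' ⟶ X) (r : ((ihom X).obj Y).P.obj c) (ρ : c ⟶ d) (a : X'.P.obj d) :
    expApp (((MonoidalClosed.pre g).app Y).φ.app c r) ρ a = expApp r ρ (g.φ.app d a) := by
  have pre_eq_curry :
      (MonoidalClosed.pre g).app Y = MonoidalClosed.curry (g ▷ _ ≫ (ihom.ev X).app Y) := by
    rw [MonoidalClosed.eq_curry_iff, MonoidalClosed.uncurry_pre]
  rw [pre_eq_curry, expApp_curry]
  exact ev_pairEl_act r ρ (g.φ.app d a)

theorem expApp_ihom_map (g : Y ⟶ Y') (r : ((ihom X).obj Y).P.obj c) (ρ : c ⟶ d)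
    (a : X.P.obj d) :
    expApp (((ihom X).map g).φ.app c r) ρ a = g.φ.app d (expApp r ρ a) := by
  have map_eq_curry : (ihom X).map g = MonoidalClosed.curry ((ihom.ev X).app Y ≫ g) := by
    rw [MonoidalClosed.eq_curry_iff, MonoidalClosed.uncurry_eq, ihom.ev_naturality]
  rw [map_eq_curry, expApp_curry, ← ev_pairEl_act]
  rfl

end Glue

/-! ### Evaluation, unquoting and quoting on elements -/

section Elements

variable {T : Type u} {S : Type w} [Category.{v} S] [CartesianMonoidalCategory S]
  [MonoidalClosed S]

/-- The elements of the presheaf of the interpretation of a type in the glueing category. -/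
abbrev El (s : T → S) (Γ : Ctx T) (τ : Ty T) : Type (max u v) :=
  (tySem (glueInterp s) τ).P.obj Γ

/-- The elements at stage `Δ` of the presheaf of the interpretation of a context `Γ` in the glueing
category: environments for the variables of `Γ`. -/
abbrev Env (s : T → S) (Δ Γ : Ctx T) : Type (max u v) :=
  (ctxProd (tySem (glueInterp s)) Γ).P.obj Δ

variable (s : T → S) {Γ Δ Θ : Ctx T} {σ τ : Ty T}

/-- The presheaf component of `unquote`. -/
def reflect (M : Ne Γ τ) : El s Γ τ := (unquote s τ).φ.app Γ ⟨M⟩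

/-- The presheaf component of `quote`. -/
def reify (a : El s Γ τ) : Nf Γ τ := ((quote s τ).φ.app Γ a).down

/-- The value of a term in an environment: the presheaf component of its glued interpretation. -/
def eval (t : Tm Γ τ) (γ : Env s Δ Γ) : El s Δ τ := (tmSem (glueInterp s) t).φ.app Δ γ

/-- The first component of an element of product type. -/
def fstEl (a : El s Γ (.prod σ τ)) : El s Γ σ := (fst _ _ : _ ⟶ tySem (glueInterp s) σ).φ.app Γ a

/-- The second component of an element of product type. -/
def sndEl (a : El s Γ (.prod σ τ)) : El s Γ τ := (snd _ _ : _ ⟶ tySem (glueInterp s) τ).φ.app Γ a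

/-- The application of an element of function type at a later stage. -/
def appEl (r : El s Γ (.arr σ τ)) (ρ : Γ ⟶ Δ) (a : El s Δ σ) : El s Δ τ :=
  Glue.expApp (X := tySem (glueInterp s) σ) (Y := tySem (glueInterp s) τ) r ρ a

theorem eval_act (t : Tm Γ τ) (ρ : Δ ⟶ Θ) (γ : Env s Δ Γ) :
    eval s t (Glue.act ρ γ) = Glue.act ρ (eval s t γ) :=
  Glue.φ_map _ ρ γ

theorem eval_app (t : Tm Γ (.arr σ τ)) (t' : Tm Γ σ) (γ : Env s Δ Γ) :
    eval s (t.app t') γ = appEl s (eval s t γ) (𝟙 Δ) (eval s t' γ) :=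
  Glue.ev_pairEl _ _

theorem appEl_eval_lam (t : Tm (Γ.ext σ) τ) (γ : Env s Δ Γ) (ρ : Δ ⟶ Θ) (a : El s Θ σ) :
    appEl s (eval s t.lam γ) ρ a = eval s t (Glue.pairEl a (Glue.act ρ γ)) :=
  Glue.expApp_curry _ _ _ _

theorem act_reflect (ρ : Γ ⟶ Δ) (M : Ne Γ τ) :
    Glue.act ρ (reflect s M) = reflect s ⟨M.1.rename ρ, M.2.rename ρ⟩ :=
  (Glue.φ_map (unquote s τ) ρ ⟨M⟩).symm

theorem fstEl_reflect (M : Ne Γ (.prod σ τ)) :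
    fstEl s (reflect s M) = reflect s ⟨M.1.fst, .fst M.2⟩ :=
  rfl

theorem sndEl_reflect (M : Ne Γ (.prod σ τ)) :
    sndEl s (reflect s M) = reflect s ⟨M.1.snd, .snd M.2⟩ :=
  rfl

theorem appEl_reflect (M : Ne Γ (.arr σ τ)) (ρ : Γ ⟶ Δ) (a : El s Δ σ) :
    appEl s (reflect s M) ρ a =
      reflect s ⟨.app (M.1.rename ρ) (reify s a).1, .app (M.2.rename ρ) (reify s a).2⟩ :=
  Glue.expApp_curry _ _ _ _

theorem reify_prod (a : El s Γ (.prod σ τ)) :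
    (reify s a).1 = .pair (reify s (fstEl s a)).1 (reify s (sndEl s a)).1 :=
  rfl

/-- The last variable of a context as an element of the interpretation of its type. -/
def lastEl (Γ : Ctx T) (σ : Ty T) : El s (Γ.ext σ) σ := reflect s ⟨.var .zero, .var _⟩

theorem reify_arr (r : El s Γ (.arr σ τ)) :
    (reify s r).1 = .lam (reify s (appEl s r (Ren.wk Γ σ) (lastEl s Γ σ))).1 := by
  let varEl : varObj s σ ⟶ tySem (glueInterp s) σ := varMap s σ ≫ unquote s σ
  let r' := ((MonoidalClosed.pre varEl).app _).φ.app Γ r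
  have apply_fresh :
      Glue.expApp (((ihom (varObj s σ)).map (quote s τ)).φ.app Γ r') (Ren.wk Γ σ) ⟨.zero⟩ =
        (quote s τ).φ.app _ (appEl s r (Ren.wk Γ σ) (lastEl s Γ σ)) :=
    (Glue.expApp_ihom_map (quote s τ) r' (Ren.wk Γ σ) ⟨.zero⟩).trans
      (congrArg ((quote s τ).φ.app _) (Glue.expApp_pre varEl r (Ren.wk Γ σ) ⟨.zero⟩))
  exact congrArg (fun N : ULift.{v} (Nf (Γ.ext σ) τ) => Tm.lam N.down.1) apply_fresh

/-- The environment sending each variable of a context to its unquoting. -/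
def idEnv (Γ : Ctx T) : Env s Γ Γ := (varCtx s Γ ≫ unquoteCtx s Γ).φ.app Γ ⟨𝟙 Γ⟩

theorem normalise_eq_reify_eval (t : Tm Γ τ) : normalise s t = reify s (eval s t (idEnv s Γ)) :=
  rfl

theorem eval_var_idEnv (x : Var Γ τ) : eval s (.var x) (idEnv s Γ) = reflect s ⟨.var x, .var x⟩ :=
  congrArg (fun g : yonObj s Γ ⟶ tySem (glueInterp s) τ => g.φ.app Γ ⟨𝟙 Γ⟩)
    (varCtx_unquoteCtx_proj s x)

theorem idEnv_ext (Γ : Ctx T) (σ : Ty T) :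
    idEnv s (Γ.ext σ) = Glue.pairEl (lastEl s Γ σ) (Glue.act (Ren.wk Γ σ) (idEnv s Γ)) := by
  apply Glue.ctxProd_el_ext
  intro τ x
  refine (eval_var_idEnv s x).trans ?_
  cases x with
  | zero => rfl
  | succ x =>
    change _ = eval s (.var x) (Glue.act (Ren.wk Γ σ) (idEnv s Γ))
    rw [eval_act, eval_var_idEnv]
    exact (act_reflect s (Ren.wk Γ σ) ⟨.var x, .var x⟩).symm

end Elements

/-! ### Normalisation of normal terms -/

section Normal

variable {T : Type u} {S : Type w} [Category.{v} S] [CartesianMonoidalCategory S]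
  [MonoidalClosed S] (s : T → S)

mutual

theorem IsNeutral.eval_idEnv {Γ : Ctx T} {τ : Ty T} {M : Tm Γ τ} :
    ∀ h : IsNeutral M, eval s M (idEnv s Γ) = reflect s ⟨M, h⟩
  | .var x => eval_var_idEnv s x
  | .fst h => congrArg (fstEl s) (IsNeutral.eval_idEnv h)
  | .snd h => congrArg (sndEl s) (IsNeutral.eval_idEnv h)
  | .app h h' => by
    rw [eval_app, IsNeutral.eval_idEnv h]
    refine (appEl_reflect s ⟨_, h⟩ (𝟙 Γ) _).trans (congrArg (reflect s) (Subtype.ext ?_))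
    exact congrArg₂ Tm.app (Tm.rename_id _) (IsNormal.reify_eval_idEnv h')

theorem IsNormal.reify_eval_idEnv {Γ : Ctx T} {τ : Ty T} {N : Tm Γ τ} :
    IsNormal N → (reify s (eval s N (idEnv s Γ))).1 = N
  | .unit => rfl
  | .pair h h' => congrArg₂ Tm.pair (IsNormal.reify_eval_idEnv h) (IsNormal.reify_eval_idEnv h')
  | .lam h => by
    rw [reify_arr, appEl_eval_lam, ← idEnv_ext, IsNormal.reify_eval_idEnv h]
  | .base h => congrArg (fun M => (reify s M).1) (IsNeutral.eval_idEnv h)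

end

variable {Γ : Ctx T} {τ : Ty T}

theorem normalise_normal (N : Nf Γ τ) : normalise s N.1 = N :=
  Subtype.ext (N.2.reify_eval_idEnv s)

theorem BetaEta.normalise_eq {t t' : Tm Γ τ} (h : BetaEta t t') :
    normalise s t = normalise s t' := by
  rw [normalise_eq_reify_eval, normalise_eq_reify_eval, eval, eval, h.tmSem_eq]

end Normal

/-! ### The logical relation between terms and elements -/

section LogicalRelation

variable {T : Type u} {S : Type w} [Category.{v} S] [CartesianMonoidalCategory S]
  [MonoidalClosed S] (s : T → S)

/-- The Kripke logical relation between terms and elements of the glued interpretation of types,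
given at base types, where elements are neutral terms, by `βη`-equality. -/
def Realises : ∀ (τ : Ty T) {Γ : Ctx T}, Tm Γ τ → El s Γ τ → Prop
  | .base b, Γ, t, a => BetaEta t (reify s (Γ := Γ) (τ := .base b) a).1
  | .unit, _, _, _ => True
  | .prod σ τ, _, t, a => Realises σ t.fst (fstEl s a) ∧ Realises τ t.snd (sndEl s a)
  | .arr σ τ, Γ, t, r => ∀ (Δ : Ctx T) (ρ : Γ ⟶ Δ) (t' : Tm Δ σ) (a : El s Δ σ),
      Realises σ t' a → Realises τ ((t.rename ρ).app t') (appEl s r ρ a)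

/-- The extension of the logical relation to simultaneous substitutions and environments. -/
def RealisesEnv {Γ Δ : Ctx T} (θ : Subst Γ Δ) (γ : Env s Δ Γ) : Prop :=
  ∀ (τ : Ty T) (x : Var Γ τ), Realises s τ (θ τ x) (eval s (.var x) γ)

variable {s} {Γ Δ : Ctx T} {σ τ : Ty T}

theorem Realises.of_betaEta {t t' : Tm Γ τ} {a : El s Γ τ} (h : BetaEta t t')
    (ht : Realises s τ t a) : Realises s τ t' a := by
  induction τ generalizing Γ with
  | base => exact h.symm.trans ht
  | unit => exact trivial
  | prod σ τ ih ih' => exact ⟨ih h.fst_congr ht.1, ih' h.snd_congr ht.2⟩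
  | arr σ τ _ ih' =>
    exact fun Δ ρ u b hu => ih' (.app_congr (h.rename ρ) (.refl u)) (ht Δ ρ u b hu)

theorem Realises.rename {t : Tm Γ τ} {a : El s Γ τ} (ht : Realises s τ t a) (ρ : Γ ⟶ Δ) :
    Realises s τ (t.rename ρ) (Glue.act ρ a) := by
  induction τ generalizing Γ with
  | base => exact BetaEta.rename ht ρ
  | unit => exact trivial
  | prod σ τ ih ih' => exact ⟨ih ht.1 ρ, ih' ht.2 ρ⟩
  | arr σ τ =>
    intro Θ ρ' u b hu
    rw [← Tm.rename_comp]
    exact ht Θ (ρ ≫ ρ') u b hu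

mutual

theorem realises_reflect : ∀ {τ : Ty T} {Γ : Ctx T} {t : Tm Γ τ} {M : Ne Γ τ},
    BetaEta t M.1 → Realises s τ t (reflect s M)
  | .base _, _, _, _, h => h
  | .unit, _, _, _, _ => trivial
  | .prod _ _, _, _, _, h =>
    ⟨fstEl_reflect s _ ▸ realises_reflect h.fst_congr,
      sndEl_reflect s _ ▸ realises_reflect h.snd_congr⟩
  | .arr _ _, _, _, _, h => fun _ ρ _ _ hu =>
    appEl_reflect s _ ρ _ ▸ realises_reflect (.app_congr (h.rename ρ) (Realises.betaEta_reify hu))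

theorem Realises.betaEta_reify : ∀ {τ : Ty T} {Γ : Ctx T} {t : Tm Γ τ} {a : El s Γ τ},
    Realises s τ t a → BetaEta t (reify s a).1
  | .base _, _, _, _, h => h
  | .unit, _, t, _, _ => .eta_unit t
  | .prod _ _, _, t, a, h => by
    rw [reify_prod]
    exact (BetaEta.eta_pair t).trans (.pair_congr h.1.betaEta_reify h.2.betaEta_reify)
  | .arr σ _, Γ, t, r, h => by
    rw [reify_arr]
    have fresh : Realises s σ (.var .zero) (lastEl s Γ σ) := realises_reflect (.refl _)
    exact (BetaEta.eta_lam t).trans (.lam_congr (h _ (Ren.wk Γ σ) _ _ fresh).betaEta_reify)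

end

theorem RealisesEnv.cons {θ : Subst Γ Δ} {γ : Env s Δ Γ} (h : RealisesEnv s θ γ)
    {t : Tm Δ σ} {a : El s Δ σ} (ht : Realises s σ t a) :
    RealisesEnv s (θ.cons t) (Glue.pairEl a γ)
  | _, .zero => ht
  | _, .succ x => h _ x

theorem RealisesEnv.rename {Θ : Ctx T} {θ : Subst Γ Δ} {γ : Env s Δ Γ} (h : RealisesEnv s θ γ)
    (ρ : Δ ⟶ Θ) : RealisesEnv s (fun τ x => (θ τ x).rename ρ) (Glue.act ρ γ) := by
  intro τ x
  rw [eval_act]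
  exact (h τ x).rename ρ

theorem realisesEnv_idEnv (Γ : Ctx T) : RealisesEnv s (fun _ x => .var x) (idEnv s Γ) := by
  intro τ x
  rw [eval_var_idEnv]
  exact realises_reflect (.refl _)

theorem RealisesEnv.subst_eval {θ : Subst Γ Δ} {γ : Env s Δ Γ} (h : RealisesEnv s θ γ)
    (t : Tm Γ τ) : Realises s τ (t.subst θ) (eval s t γ) := by
  induction t generalizing Δ with
  | var x => exact h _ x
  | unit => exact trivial
  | fst t ih => exact (ih h).1
  | snd t ih => exact (ih h).2
  | pair t t' ih ih' =>
    exact ⟨(ih h).of_betaEta (BetaEta.beta_fst _ _).symm,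
      (ih' h).of_betaEta (BetaEta.beta_snd _ _).symm⟩
  | app t t' ih ih' =>
    have h_app := ih h Δ (𝟙 Δ) _ _ (ih' h)
    rwa [Tm.rename_id, ← eval_app] at h_app
  | lam t ih =>
    intro Δ' ρ u a hu
    have h_body := ih ((h.rename ρ).cons hu)
    rw [← Tm.subst_liftSub_single, ← Tm.rename_lift_liftSub, ← Tm.rename_subst] at h_body
    rw [appEl_eval_lam]
    exact h_body.of_betaEta (BetaEta.beta_app _ u).symm

variable (s)

theorem betaEta_normalise (t : Tm Γ τ) : BetaEta (normalise s t).1 t := by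
  have h := (realisesEnv_idEnv (s := s) Γ).subst_eval t
  rw [Tm.subst_var] at h
  exact h.betaEta_reify.symm

theorem betaEta_iff_eq_normalise {N : Nf Γ τ} {t : Tm Γ τ} :
    BetaEta N.1 t ↔ N = normalise s t where
  mp h := (normalise_normal s N).symm.trans (h.normalise_eq s)
  mpr h := h ▸ betaEta_normalise s t

end LogicalRelation

end NbE

theorem mainTheorem2 (T : Type u) :
    (∀ (S : Type w) [Category.{v} S] [CartesianMonoidalCategory S] [MonoidalClosed S]
        (s : T → S) (τ : NbE.Ty T),
      NbE.nf s τ = NbE.nf (NbE.FreeCCC.of (T := T)) τ) ∧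
    ∀ (Γ : NbE.Ctx T) (τ : NbE.Ty T) (t : NbE.Tm Γ τ),
      NbE.BetaEta (NbE.normalise NbE.FreeCCC.of t).1 t ∧
        ∀ N : NbE.Nf Γ τ, NbE.BetaEta N.1 t → N = NbE.normalise NbE.FreeCCC.of t := by
  refine ⟨fun S _ _ _ s τ => ?_, fun Γ τ t =>
    ⟨NbE.betaEta_normalise _ t, fun N => (NbE.betaEta_iff_eq_normalise _).1⟩⟩
  ext Γ t
  exact (NbE.betaEta_iff_eq_normalise NbE.FreeCCC.of).1 (NbE.betaEta_normalise s t)
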